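/- Let $R$ be an integral domain with quotient field $K$. For a nonzero $R$-submodule $A$ of $K$ with $dA\subseteq R$ for some nonzero $d\in R$ (a fractional ideal), put $A^{-1}=\{x\in K: xA\subseteq R\}$, $A_v=(A^{-1})^{-1}$, $(A:A)=\{x\in K: xA\subseteq A\}$ and $A_t=\bigcup J_v$, where $J$ runs over the nonzero finitely generated $R$-submodules of $A$. A nonzero ideal $I$ of $R$ is a $t$-ideal if $I=I_t$; a $t$-maximal ideal is a maximal element of the set of proper $t$-ideals. The same notions are used for any ring $T$ with $R\subseteq T\subseteq K$. Call $R$ a PVMD (Prüfer $v$-multiplication domain) if $(JJ^{-1})_t=R$ for every nonzero finitely generated ideal $J$ of $R$, and say that $\mathrm{Spec}_t(R)$ is Noetherian if $R$ satisfies the ascending chain condition on radical $t$-ideals. **Theorem 2.5.** Let $R$ be a PVMD with $\mathrm{Spec}_t(R)$ Noetherian, and let $I$ be a $t$-ideal of $R$ (in particular $I\neq 0$) such that $I^{-1}$ is a subring of $K$. Then the following conditions are equivalent: 1. $I^{-1}=(I:I)$; 2. $I=\sqrt{I}$; 3. every prime ideal of the ring $(I:I)$ that is minimal over $I$ (which is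 an ideal of $(I:I)$) is a $t$-maximal ideal of $(I:I)$. -/

import Mathlib

/-! Star operations on an integral domain `R` with quotient field `K`.  Fractional ideals are
handled as `R`-submodules of `K`; `A / B` is Mathlib's residual
`{x : K | ∀ b ∈ B, x * b ∈ A}` and `(1 : Submodule R K)` is the image of `R` in `K`. -/

namespace PVMD

section Operations

variable {R K : Type*} [CommRing R] [Field K] [Algebra R K]

/-- The dual `A⁻¹ = (R : A) = {x ∈ K | x A ⊆ R}`. -/
def dual (A : Submodule R K) : Submodule R K := 1 / A

theorem mem_dual {A : Submodule R K} {x : K} :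
    x ∈ dual A ↔ ∀ a ∈ A, ∃ r : R, algebraMap R K r = x * a := by
  simp [dual, Submodule.mem_div_iff_forall_mul_mem, Submodule.mem_one]

theorem dual_anti {A B : Submodule R K} (h : A ≤ B) : dual B ≤ dual A :=
  fun _ hx => mem_dual.2 fun a ha => mem_dual.1 hx a (h ha)

/-- The `v`-closure `A_v = (A⁻¹)⁻¹`. -/
def vClosure (A : Submodule R K) : Submodule R K := dual (dual A)

theorem vClosure_mono {A B : Submodule R K} (h : A ≤ B) : vClosure A ≤ vClosure B :=
  dual_anti (dual_anti h)

/-- The `t`-closure of a nonzero `A`: the union of the `J_v`, for `J ⊆ A` finitely generated.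
(Allowing `J = 0` is harmless: `0_v = 0` when `R ≠ K`, and when `R = K` the only nonzero `A`
is `K` itself.) -/
def tClosure (A : Submodule R K) : Submodule R K where
  carrier := {x | ∃ J : Submodule R K, J.FG ∧ J ≤ A ∧ x ∈ vClosure J}
  zero_mem' := ⟨⊥, Submodule.fg_bot, bot_le, zero_mem _⟩
  add_mem' := by
    rintro x y ⟨J, hJ, hJA, hx⟩ ⟨L, hL, hLA, hy⟩
    exact ⟨J ⊔ L, hJ.sup hL, sup_le hJA hLA,
      add_mem (vClosure_mono le_sup_left hx) (vClosure_mono le_sup_right hy)⟩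
  smul_mem' := by
    rintro r x ⟨J, hJ, hJA, hx⟩
    exact ⟨J, hJ, hJA, Submodule.smul_mem _ r hx⟩

/-- `A` is `t`-invertible: `(A A⁻¹)_t = R`. -/
def IsTInvertible (A : Submodule R K) : Prop := tClosure (A * dual A) = 1

/-- The endomorphism ring `(A : A) = {x ∈ K | x A ⊆ A}`, as an overring of `R` in `K`. -/
def endRing (A : Submodule R K) : Subalgebra R K where
  carrier := {x | ∀ a ∈ A, x * a ∈ A}
  mul_mem' := fun {x y} hx hy a ha => by
    simpa [mul_assoc] using hx _ (hy a ha)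
  add_mem' := fun {x y} hx hy a ha => by
    simpa [add_mul] using A.add_mem (hx a ha) (hy a ha)
  algebraMap_mem' := fun r a ha => by
    simpa [Algebra.smul_def] using A.smul_mem r ha

/-- The submodule `A` of `K` is (the underlying set of) a subring of `K`. -/
def IsSubring (A : Submodule R K) : Prop := ∃ S : Subring K, (S : Set K) = A

end Operations

section Ideals

variable {R : Type*} (K : Type*) [CommRing R] [Field K] [Algebra R K]

/-- The image in `K` of an ideal of `R`. -/
abbrev toFrac (I : Ideal R) : Submodule R K := IsLocalization.coeSubmodule K I

/-- A (nonzero, integral) ideal `I` of `R` is a `t`-ideal if `I = I_t`, where `K` is the quotient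
field of `R`. -/
def IsTIdeal (I : Ideal R) : Prop := I ≠ ⊥ ∧ tClosure (toFrac K I) = toFrac K I

/-- `M` is a `t`-maximal ideal: maximal among the proper `t`-ideals of `R`. -/
def IsTMaximal (M : Ideal R) : Prop := Maximal (fun J : Ideal R => IsTIdeal K J ∧ J ≠ ⊤) M

variable (R)

/-- The domain `R` with quotient field `K` is a Prüfer `v`-multiplication domain: every nonzero
finitely generated ideal is `t`-invertible. -/
def IsPVMD : Prop := ∀ J : Ideal R, J ≠ ⊥ → J.FG → IsTInvertible (toFrac K J)

/-- The `t`-spectrum of `R` is Noetherian: the radical `t`-ideals of `R` satisfy the ascending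
chain condition. -/
def HasNoetherianTSpectrum : Prop :=
  WellFoundedGT {J : Ideal R // IsTIdeal K J ∧ J.IsRadical}

end Ideals

end PVMD

/-! In a PVMD the `t`-primes localize to valuation rings, and for `J` nonzero and finitely generated
no proper `t`-ideal contains `J J⁻¹`. Write `T = (I : I)`.

2 → 1: for `x ∈ I⁻¹` and `i ∈ I`, also `x² ∈ I⁻¹`, so `(xi)² = (x²i)i ∈ I` and `xi ∈ √I = I`.

1 → 3: let `Q` be minimal over `I` in `T`, `P = Q ∩ R`, and `N ⊇ Q` a proper `t`-ideal of `T`. If `s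
∈ N ∩ R` is outside `P`, `exists_fg_dual_le_of_notMem` gives a finitely generated `J ⊆ (s) + P ⊆ N`
with `J⁻¹ ⊆ I⁻¹ = T`. Then `J J⁻¹ ⊆ N ∩ R`, which is impossible. So `N ∩ R = P`, and clearing
denominators gives `N = Q`.

3 → 2: by `exists_mul_mem_of_mem_minimalPrimes`, `I R_P = P R_P` for `P` minimal over `I`. If `x ∈
√I \ I`, then `(I :_T x)` lies in a `t`-maximal `N`, which by 3 is minimal over `I`. Take `P ⊆ N ∩
R` minimal over `I` and `s ∉ P` with `sx ∈ I`. Then `s ∈ N`, so `t s^n ∈ I` for some `t ∉ N`;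
clearing the denominator of `t` forces `s ∈ P`, a contradiction. -/

namespace PVMD

/-! ### Formal properties of `v`-closures and colon ideals. -/

section Closure

variable {R K : Type*} [CommRing R] [Field K] [Algebra R K]

theorem mem_dual_iff {A : Submodule R K} {x : K} :
    x ∈ dual A ↔ ∀ a ∈ A, x * a ∈ (1 : Submodule R K) :=
  Submodule.mem_div_iff_forall_mul_mem

theorem mem_vClosure_iff {A : Submodule R K} {x : K} :
    x ∈ vClosure A ↔ ∀ y ∈ dual A, x * y ∈ (1 : Submodule R K) :=
  Submodule.mem_div_iff_forall_mul_mem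

theorem le_vClosure (A : Submodule R K) : A ≤ vClosure A := fun x hx =>
  mem_vClosure_iff.2 fun y hy => mul_comm y x ▸ mem_dual_iff.1 hy x hx

theorem algebraMap_mem_one (r : R) : algebraMap R K r ∈ (1 : Submodule R K) :=
  Submodule.mem_one.2 ⟨r, rfl⟩

theorem toFrac_le_one (J : Ideal R) : toFrac K J ≤ 1 := by
  rintro _ ⟨r, -, rfl⟩
  exact algebraMap_mem_one r

theorem algebraMap_mem_toFrac_of_mem {J : Ideal R} {r : R} (h : r ∈ J) :
    algebraMap R K r ∈ toFrac K J := ⟨r, h, rfl⟩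

theorem vClosure_le_one {A : Submodule R K} (hA : A ≤ 1) : vClosure A ≤ 1 := fun x hx => by
  simpa using mem_vClosure_iff.1 hx 1 (mem_dual_iff.2 fun a ha => by simpa using hA ha)

theorem mem_dual_toFrac_iff {J : Ideal R} {y : K} :
    y ∈ dual (toFrac K J) ↔ ∀ j ∈ J, y * algebraMap R K j ∈ (1 : Submodule R K) := by
  rw [mem_dual_iff]
  constructor
  · exact fun h j hj => h _ (algebraMap_mem_toFrac_of_mem hj)
  · rintro h _ ⟨j, hj, rfl⟩
    exact h j hj

theorem mul_mem_vClosure_mul {A B : Submodule R K} {x z : K} (hx : x ∈ vClosure A)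
    (hz : z ∈ vClosure B) : x * z ∈ vClosure (A * B) := by
  rw [mem_vClosure_iff]
  intro y hy
  rw [mul_assoc]
  refine mem_vClosure_iff.1 hx _ (mem_dual_iff.2 fun a ha => ?_)
  rw [mul_assoc]
  refine mem_vClosure_iff.1 hz _ (mem_dual_iff.2 fun b hb => ?_)
  rw [mul_assoc]
  exact mem_dual_iff.1 hy _ (Submodule.mul_mem_mul ha hb)

theorem pow_mem_vClosure_pow {A : Submodule R K} {x : K} (hx : x ∈ vClosure A) (n : ℕ) :
    x ^ n ∈ vClosure (A ^ n) := by
  induction n with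
  | zero =>
    simpa using le_vClosure (1 : Submodule R K)
      (Submodule.mem_one.2 ⟨1, map_one _⟩)
  | succ n ih =>
    rw [pow_succ, pow_succ]
    exact mul_mem_vClosure_mul ih hx

/-- The ideal `{r ∈ R | r x ∈ I}` of an element `x` of `K`. -/
def colon (I : Ideal R) (x : K) : Ideal R :=
  (toFrac K I).comap (LinearMap.toSpanSingleton R K x)

theorem mem_colon {I : Ideal R} {x : K} {r : R} :
    r ∈ colon I x ↔ algebraMap R K r * x ∈ toFrac K I := by
  simp [colon, Algebra.smul_def]

/-- The ideal `J_v ∩ R` of an ideal `J`. -/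
def vIdeal (K : Type*) [Field K] [Algebra R K] (J : Ideal R) : Ideal R :=
  (vClosure (toFrac K J)).comap (Algebra.linearMap R K)

theorem mem_vIdeal {J : Ideal R} {r : R} :
    r ∈ vIdeal K J ↔ algebraMap R K r ∈ vClosure (toFrac K J) := Iff.rfl

theorem le_vIdeal (J : Ideal R) : J ≤ vIdeal K J := fun _ hj =>
  le_vClosure _ (algebraMap_mem_toFrac_of_mem hj)

theorem vIdeal_mono {J L : Ideal R} (h : J ≤ L) : vIdeal K J ≤ vIdeal K L := fun _ hr =>
  vClosure_mono (IsLocalization.coeSubmodule_mono K h) hr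

theorem vIdeal_le_vIdeal_of_le {J L : Ideal R} (h : L ≤ vIdeal K J) :
    vIdeal K L ≤ vIdeal K J := fun r hr => by
  refine mem_vClosure_iff.2 fun y hy => mem_vClosure_iff.1 hr y ?_
  exact mem_dual_toFrac_iff.2 fun l hl => mul_comm y _ ▸ mem_vClosure_iff.1 (h hl) y hy

theorem pow_mem_vIdeal_pow {J : Ideal R} {r : R} (hr : r ∈ vIdeal K J) (n : ℕ) :
    r ^ n ∈ vIdeal K (J ^ n) := by
  have hpow : toFrac K (J ^ n) = toFrac K J ^ n := by
    induction n with
    | zero => simp [toFrac, Ideal.one_eq_top]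
    | succ n ih => rw [pow_succ, pow_succ, ← ih, toFrac, IsLocalization.coeSubmodule_mul]
  rw [mem_vIdeal, map_pow, hpow]
  exact pow_mem_vClosure_pow hr n

theorem exists_toFrac_eq {L : Submodule R K} (hL : L ≤ 1) :
    ∃ J : Ideal R, toFrac K J = L :=
  ⟨L.comap (Algebra.linearMap R K), Submodule.map_comap_eq_of_le
    (hL.trans_eq Submodule.one_eq_range)⟩

theorem IsTMaximal.isTIdeal {M : Ideal R} (hM : IsTMaximal K M) : IsTIdeal K M := hM.prop.1

end Closure

/-! ### `t`-ideals and `t`-maximal ideals. -/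

section Fraction

variable {R K : Type*} [CommRing R] [Field K] [Algebra R K] [IsFractionRing R K]

theorem algebraMap_mem_toFrac {J : Ideal R} {r : R} :
    algebraMap R K r ∈ toFrac K J ↔ r ∈ J := by
  refine ⟨?_, algebraMap_mem_toFrac_of_mem⟩
  rintro ⟨s, hs, h⟩
  exact IsFractionRing.injective R K h ▸ hs

theorem fg_of_toFrac_fg {J : Ideal R} (h : (toFrac K J).FG) : J.FG :=
  (IsLocalization.coeSubmodule_fg K (IsFractionRing.injective R K) J).1 h

theorem toFrac_fg {J : Ideal R} (h : J.FG) : (toFrac K J).FG :=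
  (IsLocalization.coeSubmodule_fg K (IsFractionRing.injective R K) J).2 h

theorem isTIdeal_iff {I : Ideal R} : IsTIdeal K I ↔
    I ≠ ⊥ ∧ ∀ J : Ideal R, J.FG → J ≤ I → vIdeal K J ≤ I := by
  refine and_congr_right fun _ => ⟨fun h J hJ hJI r hr => ?_, fun h => le_antisymm ?_ ?_⟩
  · rw [← algebraMap_mem_toFrac (K := K), ← h]
    exact ⟨_, toFrac_fg hJ, IsLocalization.coeSubmodule_mono K hJI, hr⟩
  · rintro x ⟨L, hL, hLI, hx⟩
    obtain ⟨J, rfl⟩ := exists_toFrac_eq (hLI.trans (toFrac_le_one I))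
    obtain ⟨r, rfl⟩ := Submodule.mem_one.1 (vClosure_le_one (toFrac_le_one J) hx)
    refine algebraMap_mem_toFrac_of_mem (h J (fg_of_toFrac_fg hL) ?_ hx)
    exact fun j hj => algebraMap_mem_toFrac.1 (hLI (algebraMap_mem_toFrac_of_mem hj))
  · intro x hx
    exact ⟨_, Submodule.fg_span_singleton x, by simpa using hx,
      le_vClosure _ (Submodule.mem_span_singleton_self x)⟩

theorem IsTIdeal.vIdeal_le {I J : Ideal R} (hI : IsTIdeal K I) (hJ : J.FG) (hJI : J ≤ I) :
    vIdeal K J ≤ I := (isTIdeal_iff.1 hI).2 J hJ hJI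

theorem isTIdeal_vIdeal {J : Ideal R} (hJ : J ≠ ⊥) : IsTIdeal K (vIdeal K J) :=
  isTIdeal_iff.2 ⟨ne_bot_of_le_ne_bot hJ (le_vIdeal J), fun _ _ h => vIdeal_le_vIdeal_of_le h⟩

theorem IsTIdeal.radical {I : Ideal R} (hI : IsTIdeal K I) : IsTIdeal K I.radical := by
  refine isTIdeal_iff.2 ⟨ne_bot_of_le_ne_bot hI.1 Ideal.le_radical, fun J hJ hJI r hr => ?_⟩
  obtain ⟨n, hn⟩ := Ideal.exists_pow_le_of_le_radical_of_fg hJI hJ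
  exact ⟨n, hI.vIdeal_le (hJ.pow) hn (pow_mem_vIdeal_pow hr n)⟩

/-- The working form of `t`-invertibility: if every product `y j` fell in `A`, then `1 ∈ (J J⁻¹)_t ⊆
A_t = A`. -/
theorem IsPVMD.exists_mul_notMem (hR : IsPVMD R K) {J A : Ideal R} (hJ : J.FG) (hJ0 : J ≠ ⊥)
    (hA : IsTIdeal K A) (hA1 : A ≠ ⊤) :
    ∃ y ∈ dual (toFrac K J), ∃ j ∈ J, ∃ u ∉ A, algebraMap R K u = y * algebraMap R K j := by
  by_contra! hcon
  have hle : toFrac K J * dual (toFrac K J) ≤ toFrac K A := by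
    refine Submodule.mul_le.2 ?_
    rintro _ ⟨j, hj, rfl⟩ y hy
    obtain ⟨u, hu⟩ := Submodule.mem_one.1 (mem_dual_toFrac_iff.1 hy j hj)
    rw [Algebra.linearMap_apply, mul_comm, ← hu, algebraMap_mem_toFrac]
    by_contra hu'
    exact hcon y hy j hj u hu' hu
  have h1 : (1 : K) ∈ tClosure (toFrac K J * dual (toFrac K J)) := by
    rw [hR J hJ0 hJ]
    exact Submodule.mem_one.2 ⟨1, map_one _⟩
  obtain ⟨L, hL, hLle, hL1⟩ := h1
  apply (Ideal.ne_top_iff_one A).1 hA1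
  rw [← algebraMap_mem_toFrac (K := K), ← hA.2, map_one]
  exact ⟨L, hL, hLle.trans hle, hL1⟩

theorem isTIdeal_top : IsTIdeal K (⊤ : Ideal R) :=
  have : IsDomain R := (IsFractionRing.injective R K).isDomain (algebraMap R K)
  isTIdeal_iff.2 ⟨top_ne_bot, fun _ _ _ => le_top⟩

theorem IsTIdeal.colon {I : Ideal R} (hI : IsTIdeal K I) (x : K) : IsTIdeal K (colon I x) := by
  have : IsDomain R := (IsFractionRing.injective R K).isDomain (algebraMap R K)
  refine isTIdeal_iff.2 ⟨?_, fun J hJ hJI r hr => ?_⟩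
  · obtain ⟨i, hi, hi0⟩ := Submodule.exists_mem_ne_zero_of_ne_bot hI.1
    obtain ⟨a, b, hb, rfl⟩ := IsFractionRing.div_surjective (A := R) x
    have hb0 := nonZeroDivisors.ne_zero hb
    have hb1 : algebraMap R K b ≠ 0 := by simpa using hb0
    -- With `x = a / b`, the product `(i b) x = i a` lies in `I`.
    refine (Submodule.ne_bot_iff _).2 ⟨i * b, mem_colon.2 ⟨i * a, I.mul_mem_right a hi, ?_⟩,
      mul_ne_zero hi0 hb0⟩
    simp only [Algebra.linearMap_apply, map_mul]
    field_simp
  · rw [mem_colon, ← hI.2]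
    refine ⟨toFrac K J * Submodule.span R {x}, (toFrac_fg hJ).mul (Submodule.fg_span_singleton x),
      Submodule.mul_le.2 ?_, mul_mem_vClosure_mul hr (le_vClosure _
        (Submodule.mem_span_singleton_self x))⟩
    rintro _ ⟨j, hj, rfl⟩ y hy
    obtain ⟨s, rfl⟩ := Submodule.mem_span_singleton.1 hy
    rw [mul_smul_comm]
    exact Submodule.smul_mem _ s (mem_colon.1 (hJI hj))

theorem IsTIdeal.exists_le_isTMaximal {I : Ideal R} (hI : IsTIdeal K I) (hI1 : I ≠ ⊤) :
    ∃ M, I ≤ M ∧ IsTMaximal K M := by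
  refine zorn_le_nonempty₀ {J : Ideal R | IsTIdeal K J ∧ J ≠ ⊤} (fun c hc hchain y hy => ?_) I
    ⟨hI, hI1⟩
  have hne : c.Nonempty := ⟨y, hy⟩
  refine ⟨sSup c, ⟨isTIdeal_iff.2 ⟨ne_bot_of_le_ne_bot (hc hy).1.1 (le_sSup hy),
    fun J hJ hJc => ?_⟩, ?_⟩, fun z hz => le_sSup hz⟩
  · obtain ⟨z, hz, hJz⟩ := (CompleteLattice.isCompactElement_iff_le_of_directed_sSup_le _ J).1
      ((Submodule.fg_iff_compact J).1 hJ) c hne hchain.directedOn hJc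
    exact ((hc hz).1.vIdeal_le hJ hJz).trans (le_sSup hz)
  · rw [Ideal.ne_top_iff_one, Submodule.mem_sSup_of_directed hne hchain.directedOn]
    rintro ⟨z, hz, h1⟩
    exact (Ideal.ne_top_iff_one z).1 (hc hz).2 h1

theorem IsTMaximal.isPrime {M : Ideal R} (hM : IsTMaximal K M) : M.IsPrime := by
  refine ⟨hM.prop.2, fun {a b} hab => or_iff_not_imp_left.2 fun ha => ?_⟩
  have hle : M ≤ PVMD.colon M (algebraMap R K a) := fun m hm => by
    rw [mem_colon, ← map_mul, algebraMap_mem_toFrac]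
    exact M.mul_mem_right a hm
  refine hM.le_of_ge ⟨hM.isTIdeal.colon _, ?_⟩ hle ?_
  · rw [Ideal.ne_top_iff_one, mem_colon, ← map_mul, algebraMap_mem_toFrac, one_mul]
    exact ha
  · rwa [mem_colon, ← map_mul, algebraMap_mem_toFrac, mul_comm]

/-- For `y ∈ J⁻¹` and `i ∈ I`, the denominators of `y i` form a `t`-ideal. By hypothesis it lies in
no `t`-maximal ideal, so it is `R`. -/
theorem dual_le_dual_of_locally_le {I J : Ideal R}
    (h : ∀ M : Ideal R, IsTMaximal K M → M.IsPrime → ∀ i ∈ I, ∃ u ∉ M, u * i ∈ J) :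
    dual (toFrac K J) ≤ dual (toFrac K I) := by
  intro y hy
  refine mem_dual_toFrac_iff.2 fun i hi => ?_
  by_contra hyi
  obtain ⟨M, hM, hMmax⟩ := IsTIdeal.exists_le_isTMaximal
    ((isTIdeal_top (R := R)).colon (y * algebraMap R K i))
    (fun htop => hyi (by
      rw [Ideal.eq_top_iff_one, mem_colon, map_one, one_mul] at htop
      exact toFrac_le_one (⊤ : Ideal R) htop))
  obtain ⟨u, hu, hui⟩ := h M hMmax hMmax.isPrime i hi
  refine hu (hM (mem_colon.2 ?_))
  rw [mul_left_comm, ← map_mul, toFrac, IsLocalization.coeSubmodule_top]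
  exact mem_dual_toFrac_iff.1 hy _ hui

end Fraction

/-! ### Minimal primes of `t`-ideals. -/

section MinimalPrimes

/-- Otherwise some prime over `I` avoids both `R \ P` and `a`; it lies in `P`, hence equals `P` by
minimality, yet misses `a`. -/
theorem exists_mul_pow_mem_of_mem_minimalPrimes {R : Type*} [CommRing R] {I P : Ideal R}
    (hP : P ∈ I.minimalPrimes) {a : R} (ha : a ∈ P) : ∃ s ∉ P, ∃ n : ℕ, s * a ^ n ∈ I := by
  have := hP.1.1
  by_contra! hcon
  obtain ⟨Q, hQ, hIQ, hdisj⟩ := Ideal.exists_le_prime_disjoint I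
    (P.primeCompl ⊔ Submonoid.powers a) (Set.disjoint_left.2 fun x hx hxS => by
      obtain ⟨s, hs, _, ⟨n, rfl⟩, rfl⟩ := Submonoid.mem_sup.1 hxS
      exact hcon s hs n hx)
  have hQP : Q ≤ P := fun x hx => by
    by_contra hxP
    exact Set.disjoint_left.1 hdisj hx (Submonoid.mem_sup_left hxP)
  exact Set.disjoint_left.1 hdisj (hP.2 ⟨hQ, hIQ⟩ hQP ha)
    (Submonoid.mem_sup_right (Submonoid.mem_powers a))

theorem exists_mul_mem_radical_of_fg {R : Type*} [CommRing R] {I P J : Ideal R}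
    (hP : P ∈ I.minimalPrimes) (hJ : J.FG) (hJP : J ≤ P) : ∃ s ∉ P, ∀ j ∈ J, s * j ∈ I.radical := by
  have hprime := hP.1.1
  induction J, hJ using Submodule.fg_induction with
  | singleton a =>
    obtain ⟨s, hs, n, hn⟩ := exists_mul_pow_mem_of_mem_minimalPrimes hP
      (hJP (Submodule.mem_span_singleton_self a))
    have hrad : s * a ∈ I.radical := by
      rcases n with _ | n
      · exact I.le_radical (I.mul_mem_right a (by simpa using hn))
      · refine ⟨n + 1, ?_⟩
        rw [mul_pow, pow_succ s, mul_assoc]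
        exact I.mul_mem_left _ hn
    refine ⟨s, hs, fun j hj => ?_⟩
    obtain ⟨r, rfl⟩ := Ideal.mem_span_singleton'.1 hj
    rw [mul_left_comm]
    exact Ideal.mul_mem_left _ r hrad
  | sup J₁ J₂ _ _ ih₁ ih₂ =>
    obtain ⟨s, hs, h₁⟩ := ih₁ (le_sup_left.trans hJP)
    obtain ⟨t, ht, h₂⟩ := ih₂ (le_sup_right.trans hJP)
    refine ⟨s * t, fun h => (hprime.mem_or_mem h).elim hs ht, fun j hj => ?_⟩
    obtain ⟨j₁, hj₁, j₂, hj₂, rfl⟩ := Submodule.mem_sup.1 hj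
    have e : s * t * (j₁ + j₂) = t * (s * j₁) + s * (t * j₂) := by ring
    rw [e]
    exact add_mem (Ideal.mul_mem_left _ _ (h₁ j₁ hj₁)) (Ideal.mul_mem_left _ _ (h₂ j₂ hj₂))

variable {R K : Type*} [CommRing R] [Field K] [Algebra R K] [IsFractionRing R K]

/-- Some `s ∉ P` has `s J ⊆ √I`; as `√I` is a `t`-ideal, `s J_v ⊆ √I ⊆ P`. -/
theorem IsTIdeal.of_mem_minimalPrimes {I P : Ideal R} (hI : IsTIdeal K I)
    (hP : P ∈ I.minimalPrimes) : IsTIdeal K P := by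
  have hprime := hP.1.1
  refine isTIdeal_iff.2 ⟨ne_bot_of_le_ne_bot hI.1 hP.1.2, fun J hJ hJP r hr => ?_⟩
  obtain ⟨s, hs, hsJ⟩ := exists_mul_mem_radical_of_fg hP hJ hJP
  have hle : J ≤ PVMD.colon I.radical (algebraMap R K s) := fun j hj => by
    rw [mem_colon, ← map_mul, algebraMap_mem_toFrac, mul_comm]
    exact hsJ j hj
  have hmem := (hI.radical.colon (algebraMap R K s)).vIdeal_le hJ hle hr
  rw [mem_colon, ← map_mul, algebraMap_mem_toFrac] at hmem
  exact (hprime.mem_or_mem (hprime.radical_le_iff.2 hP.1.2 hmem)).resolve_right hs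

end MinimalPrimes

/-! ### PVMDs with Noetherian `t`-spectrum. -/

section PVMD

variable {R K : Type*} [CommRing R] [Field K] [Algebra R K] [IsFractionRing R K]

/-- A `t`-prime of a PVMD localizes to a valuation ring. -/
theorem IsPVMD.exists_mul_eq_mul (hR : IsPVMD R K) {M : Ideal R} (hM : IsTIdeal K M)
    (hM1 : M ≠ ⊤) (a b : R) : ∃ u ∉ M, ∃ r, u * a = r * b ∨ u * b = r * a := by
  by_cases hab : a = 0
  · exact ⟨1, (Ideal.ne_top_iff_one M).1 hM1, 0, .inl (by simp [hab])⟩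
  have ha : a ∈ Ideal.span {a, b} := Ideal.subset_span (by simp)
  have hb : b ∈ Ideal.span {a, b} := Ideal.subset_span (by simp)
  obtain ⟨y, hy, j, hj, u, hu, huj⟩ := hR.exists_mul_notMem (J := Ideal.span {a, b})
    (Submodule.fg_span (by simp)) ((Submodule.ne_bot_iff _).2 ⟨a, ha, hab⟩) hM hM1
  obtain ⟨v, hv⟩ := Submodule.mem_one.1 (mem_dual_toFrac_iff.1 hy a ha)
  obtain ⟨w, hw⟩ := Submodule.mem_one.1 (mem_dual_toFrac_iff.1 hy b hb)
  have hvw : v * b = w * a := IsFractionRing.injective R K (by rw [map_mul, map_mul, hv, hw]; ring)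
  by_cases hvM : v ∈ M
  · refine ⟨w, fun hwM => hu ?_, v, .inl hvw.symm⟩
    obtain ⟨c, d, rfl⟩ := Ideal.mem_span_pair.1 hj
    have : u = c * v + d * w := IsFractionRing.injective R K (by
      rw [huj, map_add, map_add, map_mul, map_mul, map_mul, map_mul, hv, hw]; ring)
    rw [this]
    exact add_mem (M.mul_mem_left c hvM) (M.mul_mem_left d hwM)
  · exact ⟨v, hvM, w, .inr hvw⟩

theorem IsPVMD.exists_mul_eq_mul_of_mem_of_notMem (hR : IsPVMD R K) {M P : Ideal R}
    (hM : IsTIdeal K M) (hM1 : M ≠ ⊤) [hP : P.IsPrime] (hPM : P ≤ M) {a s : R} (ha : a ∈ P)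
    (hs : s ∉ P) : ∃ u ∉ M, ∃ r ∈ P, u * a = r * s := by
  obtain ⟨u, hu, r, h | h⟩ := hR.exists_mul_eq_mul hM hM1 a s
  · exact ⟨u, hu, r, (hP.mem_or_mem (h ▸ P.mul_mem_left u ha)).resolve_right hs, h⟩
  · exact absurd (h ▸ P.mul_mem_left r ha : u * s ∈ P)
      fun h' => (hP.mem_or_mem h').elim (fun hu' => hu (hPM hu')) hs

/-- Choose `J` with `√(J_v)` maximal: adjoining `a ∈ P` to `J` does not enlarge it, so `P ⊆ √(J_v)`,
which lies in every `t`-prime over `J`. -/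
theorem HasNoetherianTSpectrum.exists_fg_le (hspec : HasNoetherianTSpectrum R K) {P : Ideal R}
    (hP : P ≠ ⊥) : ∃ J : Ideal R, J.FG ∧ J ≠ ⊥ ∧ J ≤ P ∧
      ∀ M : Ideal R, IsTIdeal K M → M.IsPrime → J ≤ M → P ≤ M := by
  let rad (J : {J : Ideal R // J.FG ∧ J ≠ ⊥ ∧ J ≤ P}) :
      {J : Ideal R // IsTIdeal K J ∧ J.IsRadical} :=
    ⟨(vIdeal K J.1).radical, (isTIdeal_vIdeal J.2.2.1).radical, Ideal.radical_isRadical _⟩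
  obtain ⟨p, hp, hp0⟩ := Submodule.exists_mem_ne_zero_of_ne_bot hP
  have hne : (Set.range rad).Nonempty := ⟨_, ⟨Ideal.span {p}, Submodule.fg_span_singleton p,
    by simpa using hp0, by simpa using hp⟩, rfl⟩
  obtain ⟨_, ⟨J, rfl⟩, hmax⟩ := hspec.wf.has_min _ hne
  refine ⟨J.1, J.2.1, J.2.2.1, J.2.2.2, fun M hM hMp hJM a ha => ?_⟩
  let J' : {J : Ideal R // J.FG ∧ J ≠ ⊥ ∧ J ≤ P} := ⟨J.1 ⊔ Ideal.span {a},
    Submodule.FG.sup J.2.1 (Submodule.fg_span_singleton a), ne_bot_of_le_ne_bot J.2.2.1 le_sup_left,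
    sup_le J.2.2.2 (by simpa using ha)⟩
  have hle : rad J ≤ rad J' := Ideal.radical_mono (vIdeal_mono le_sup_left)
  have heq : rad J' ≤ rad J := by
    by_contra h
    exact hmax _ ⟨J', rfl⟩ (lt_of_le_not_ge hle h)
  have ha' : a ∈ (vIdeal K J.1).radical := heq (Ideal.le_radical (le_vIdeal _
    ((le_sup_right : _ ≤ J'.1) (Ideal.mem_span_singleton_self a))))
  exact hMp.radical_le_iff.2 (hM.vIdeal_le J.2.1 hJM) ha'

/-- If the `t`-prime `P` contains `I` but not `s`, then some finitely generated `J ≤ (s) + P`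
satisfies `J⁻¹ ≤ I⁻¹`. -/
theorem IsPVMD.exists_fg_dual_le_of_notMem (hR : IsPVMD R K) (hspec : HasNoetherianTSpectrum R K)
    {I P : Ideal R} (hP : IsTIdeal K P) [P.IsPrime] (hIP : I ≤ P) {s : R} (hs : s ∉ P) :
    ∃ J : Ideal R, J.FG ∧ J ≠ ⊥ ∧ J ≤ Ideal.span {s} ⊔ P ∧
      dual (toFrac K J) ≤ dual (toFrac K I) := by
  obtain ⟨J, hJ, hJ0, hJP, hJM⟩ := hspec.exists_fg_le hP.1
  refine ⟨Ideal.span {s} ⊔ J, (Submodule.fg_span_singleton s).sup hJ,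
    ne_bot_of_le_ne_bot hJ0 le_sup_right, sup_le_sup_left hJP _,
    dual_le_dual_of_locally_le fun M hM hMp i hi => ?_⟩
  by_cases hle : Ideal.span {s} ⊔ J ≤ M
  · obtain ⟨u, hu, r, -, h⟩ := hR.exists_mul_eq_mul_of_mem_of_notMem hM.isTIdeal hMp.ne_top
      (hJM M hM.isTIdeal hMp (le_sup_right.trans hle)) (hIP hi) hs
    refine ⟨u, hu, h ▸ Ideal.mul_mem_left _ r ?_⟩
    exact (le_sup_left : _ ≤ Ideal.span {s} ⊔ J) (Ideal.mem_span_singleton_self s)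
  · obtain ⟨u, hu, huM⟩ := SetLike.not_le_iff_exists.1 hle
    exact ⟨u, huM, Ideal.mul_mem_right i _ hu⟩

/-- If `I⁻¹` is a ring, then `I R_P = P R_P` for every minimal prime `P` of `I`. -/
theorem IsPVMD.exists_mul_mem_of_mem_minimalPrimes (hR : IsPVMD R K)
    (hspec : HasNoetherianTSpectrum R K) {I P : Ideal R} (hI : IsTIdeal K I)
    (hring : IsSubring (dual (toFrac K I))) (hP : P ∈ I.minimalPrimes) {b : R} (hb : b ∈ P) :
    ∃ s ∉ P, s * b ∈ I := by
  have : IsDomain R := (IsFractionRing.injective R K).isDomain (algebraMap R K)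
  by_contra! hcon
  have hprime := hP.1.1
  have hPt := hI.of_mem_minimalPrimes hP
  obtain ⟨J₀, hJ₀, hJ₀0, hJ₀P, hJ₀M⟩ := hspec.exists_fg_le hPt.1
  set J := Ideal.span {b} ⊔ J₀ with hJdef
  have hJ : J.FG := (Submodule.fg_span_singleton b).sup hJ₀
  have hJ0 : J ≠ ⊥ := ne_bot_of_le_ne_bot hJ₀0 le_sup_right
  have hJP : J ≤ P := sup_le (by simpa using hb) hJ₀P
  have hbJ : b ∈ J := (le_sup_left : _ ≤ J) (Ideal.mem_span_singleton_self b)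
  have hdual : dual (toFrac K J) ≤ dual (toFrac K I) :=
    dual_le_dual_of_locally_le fun M hM hMp i hi => by
      by_cases hle : J ≤ M
      · have hPM := hJ₀M M hM.isTIdeal hMp (le_sup_right.trans hle)
        obtain ⟨u, hu, r, h⟩ := hR.exists_mul_eq_mul hPt hprime.ne_top i b
        -- As `b ∉ I R_P`, the valuation ring `R_P` gives `i / b = r / u ∈ P R_P`; this fraction can
        -- be rewritten with a denominator outside `M`.
        have h : u * i = r * b := h.resolve_right fun h =>
          hcon u hu (h ▸ I.mul_mem_left r hi)
        have hr : r ∈ P := by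
          by_contra hr
          exact hcon r hr (h ▸ I.mul_mem_left u hi)
        obtain ⟨w, hw, q, -, hq⟩ := hR.exists_mul_eq_mul_of_mem_of_notMem hM.isTIdeal hMp.ne_top
          hPM hr hu
        have hu0 : u ≠ 0 := fun h0 => hu (h0 ▸ P.zero_mem)
        have hwi : w * i = q * b := mul_left_cancel₀ hu0 (by linear_combination w * h + b * hq)
        exact ⟨w, hw, hwi ▸ J.mul_mem_left q hbJ⟩
      · obtain ⟨u, hu, huM⟩ := SetLike.not_le_iff_exists.1 hle
        exact ⟨u, huM, J.mul_mem_right i hu⟩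
  obtain ⟨y, hy, c, hc, u, hu, huc⟩ := hR.exists_mul_notMem hJ hJ0 hPt hprime.ne_top
  obtain ⟨s, hs, n, hsc⟩ := exists_mul_pow_mem_of_mem_minimalPrimes hP (hJP hc)
  obtain ⟨S, hS⟩ := hring
  -- One factor `y` more than `c ^ n` needs: multiplying `y ^ (n + 1) * (s * c ^ n) ∈ R` by `c ∈ P`
  -- gives `u ^ (n + 1) * s ∈ P`.
  have hyn : y ^ (n + 1) ∈ dual (toFrac K I) := by
    have hyS : y ∈ S := by
      rw [← SetLike.mem_coe, hS]
      exact hdual hy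
    rw [← SetLike.mem_coe, ← hS]
    exact pow_mem hyS _
  obtain ⟨r, hr⟩ := Submodule.mem_one.1 (mem_dual_toFrac_iff.1 hyn _ hsc)
  have key : u ^ (n + 1) * s = r * c := IsFractionRing.injective R K (by
    simp only [map_mul, map_pow, huc, hr]
    ring)
  have hmem : u ^ (n + 1) * s ∈ P := key ▸ P.mul_mem_left r (hJP hc)
  exact (hprime.mem_or_mem hmem).elim (fun h => hu (hprime.mem_of_pow_mem _ h)) hs

end PVMD

/-! ### The overring `(I : I)` and the three implications. -/

section EndRing

variable {R K : Type*} [CommRing R] [Field K] [Algebra R K]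

theorem mem_endRing_toFrac_iff {I : Ideal R} {x : K} :
    x ∈ endRing (toFrac K I) ↔ ∀ i ∈ I, x * algebraMap R K i ∈ toFrac K I := by
  constructor
  · exact fun h i hi => h _ (algebraMap_mem_toFrac_of_mem hi)
  · rintro h _ ⟨i, hi, rfl⟩
    exact h i hi

theorem endRing_le_dual (I : Ideal R) :
    Subalgebra.toSubmodule (endRing (toFrac K I)) ≤ dual (toFrac K I) := fun _ hx =>
  mem_dual_iff.2 fun a ha => toFrac_le_one I (hx a ha)

/-- The extension of `I` to `(I : I)` is `I` itself. -/
theorem mem_map_endRing_iff {I : Ideal R} {t : endRing (toFrac K I)} :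
    t ∈ I.map (algebraMap R (endRing (toFrac K I))) ↔ (t : K) ∈ toFrac K I := by
  constructor
  · intro ht
    induction ht using Submodule.span_induction with
    | mem x hx =>
      obtain ⟨i, hi, rfl⟩ := hx
      exact algebraMap_mem_toFrac_of_mem hi
    | zero => exact zero_mem _
    | add x y _ _ hx hy => exact add_mem hx hy
    | smul a x _ hx => exact a.2 _ hx
  · rintro ⟨i, hi, h⟩
    have ht : t = algebraMap R (endRing (toFrac K I)) i := Subtype.ext h.symm
    exact ht ▸ Ideal.mem_map_of_mem _ hi

variable [IsFractionRing R K]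

instance isFractionRing_subalgebra (T : Subalgebra R K) : IsFractionRing T K :=
  IsFractionRing.of_field T K fun z => by
    obtain ⟨a, b, -, rfl⟩ := IsFractionRing.div_surjective (A := R) z
    exact ⟨algebraMap R T a, algebraMap R T b, rfl⟩

theorem exists_fg_le_of_fg_le_map {S : Type*} [CommRing S] (f : R →+* S) {I : Ideal R}
    (hI : I ≠ ⊥) (hf : ∀ x ∈ I.map f, ∃ i ∈ I, f i = x) {L : Ideal S} (hL : L.FG)
    (hLI : L ≤ I.map f) : ∃ J : Ideal R, J.FG ∧ J ≠ ⊥ ∧ J ≤ I ∧ L ≤ J.map f := by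
  induction L, hL using Submodule.fg_induction with
  | singleton x =>
    obtain ⟨i, hi, rfl⟩ := hf x (hLI (Submodule.mem_span_singleton_self x))
    obtain ⟨j, hj, hj0⟩ := Submodule.exists_mem_ne_zero_of_ne_bot hI
    -- The generator `j` only keeps the ideal nonzero, since `i` may vanish.
    refine ⟨Ideal.span {i, j}, Submodule.fg_span (by simp), (Submodule.ne_bot_iff _).2
      ⟨j, Ideal.subset_span (by simp), hj0⟩, Ideal.span_le.2 ?_, ?_⟩
    · rintro _ (rfl | rfl) <;> assumption
    · exact (Submodule.span_singleton_le_iff_mem _ _).2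
        (Ideal.mem_map_of_mem f (Ideal.subset_span (by simp)))
  | sup L₁ L₂ _ _ ih₁ ih₂ =>
    obtain ⟨J₁, h₁, h₁0, h₁I, h₁L⟩ := ih₁ (le_sup_left.trans hLI)
    obtain ⟨J₂, h₂, -, h₂I, h₂L⟩ := ih₂ (le_sup_right.trans hLI)
    exact ⟨J₁ ⊔ J₂, Submodule.FG.sup h₁ h₂, ne_bot_of_le_ne_bot h₁0 le_sup_left, sup_le h₁I h₂I,
      (sup_le_sup h₁L h₂L).trans_eq (Ideal.map_sup f J₁ J₂).symm⟩

/-- Let `x ∈ L_v` over `T`, with `L ⊆ J T`. Any `y ∈ J⁻¹` sends `L` into `T`, so `x y ∈ T` and `(y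
j) x ∈ I` for `j ∈ J`. Thus `J J⁻¹` lies in the `t`-ideal `(I :_R x)`, which must be `R`. -/
theorem IsPVMD.isTIdeal_map_endRing (hR : IsPVMD R K) {I : Ideal R} (hI : IsTIdeal K I) :
    IsTIdeal K (I.map (algebraMap R (endRing (toFrac K I)))) := by
  have : IsDomain R := (IsFractionRing.injective R K).isDomain (algebraMap R K)
  let T := endRing (toFrac K I)
  have hinj : Function.Injective (algebraMap R T) := FaithfulSMul.algebraMap_injective R T
  refine isTIdeal_iff.2 ⟨fun h => hI.1 ((Ideal.map_eq_bot_iff_of_injective hinj).1 h),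
    fun L hL hLI x hx => mem_map_endRing_iff.2 ?_⟩
  obtain ⟨J, hJ, hJ0, hJI, hLJ⟩ := exists_fg_le_of_fg_le_map (algebraMap R T) hI.1 (fun t ht => by
    obtain ⟨i, hi, h⟩ := mem_map_endRing_iff.1 ht
    exact ⟨i, hi, Subtype.ext h⟩) hL hLI
  by_cases htop : PVMD.colon I (x : K) = ⊤
  · have h1 : (1 : R) ∈ PVMD.colon I (x : K) := htop ▸ Submodule.mem_top
    rwa [mem_colon, map_one, one_mul] at h1
  obtain ⟨y, hy, j, hj, u, hu, huj⟩ := hR.exists_mul_notMem hJ hJ0 (hI.colon (x : K)) htop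
  refine absurd (mem_colon.2 ?_) hu
  have hyL : y ∈ dual (toFrac K L) := mem_dual_toFrac_iff.2 fun l hl => by
    have hle : J.map (algebraMap R T) ≤ PVMD.colon ⊤ y := Ideal.map_le_iff_le_comap.2 fun a ha => by
      obtain ⟨r, hr⟩ := Submodule.mem_one.1 (mem_dual_toFrac_iff.1 hy a ha)
      exact mem_colon.2 ⟨algebraMap R T r, trivial, hr.trans (mul_comm _ _)⟩
    exact mul_comm y _ ▸ toFrac_le_one ⊤ (mem_colon.1 (hle (hLJ hl)))
  obtain ⟨t, ht⟩ := Submodule.mem_one.1 (mem_vClosure_iff.1 hx y hyL)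
  have := t.2 _ (algebraMap_mem_toFrac_of_mem (hJI hj))
  have e : algebraMap R K u * (x : K) = t * algebraMap R K j := by
    rw [huj, show (t : K) = x * y from ht]
    ring
  rwa [e]

theorem IsTIdeal.comap_endRing {I : Ideal R} (hI : IsTIdeal K I)
    {N : Ideal (endRing (toFrac K I))} (hN : IsTIdeal K N) :
    IsTIdeal K (N.comap (algebraMap R (endRing (toFrac K I)))) := by
  have : IsDomain R := (IsFractionRing.injective R K).isDomain (algebraMap R K)
  let T := endRing (toFrac K I)
  have hinj : Function.Injective (algebraMap R T) := FaithfulSMul.algebraMap_injective R T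
  refine isTIdeal_iff.2 ⟨?_, fun J hJ hJN r hr => ?_⟩
  · obtain ⟨t, ht, ht0⟩ := Submodule.exists_mem_ne_zero_of_ne_bot hN.1
    obtain ⟨i, hi, hi0⟩ := Submodule.exists_mem_ne_zero_of_ne_bot hI.1
    obtain ⟨a, ha, hat⟩ := t.2 _ (algebraMap_mem_toFrac_of_mem hi)
    have e : algebraMap R T a = t * algebraMap R T i := Subtype.ext hat
    refine (Submodule.ne_bot_iff _).2 ⟨a, Ideal.mem_comap.2 (e ▸ N.mul_mem_right _ ht), ?_⟩
    rintro rfl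
    rw [map_zero] at e
    exact mul_ne_zero ht0 ((map_ne_zero_iff _ hinj).2 hi0) e.symm
  · refine hN.vIdeal_le (Ideal.FG.map hJ _) (Ideal.map_le_iff_le_comap.2 hJN)
      (mem_vClosure_iff.2 fun y hy => ?_)
    -- For `i ∈ I`, `J` lies in the `t`-ideal `(I :_R y i)`, hence so does `r ∈ J_v`.
    have hmem : algebraMap R K r * y ∈ T := mem_endRing_toFrac_iff.2 fun i hi => by
      rw [mul_assoc, ← mem_colon]
      refine (hI.colon _).vIdeal_le hJ (fun j hj => mem_colon.2 ?_) hr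
      obtain ⟨t, ht⟩ := Submodule.mem_one.1
        (mem_dual_toFrac_iff.1 hy _ (Ideal.mem_map_of_mem (algebraMap R T) hj))
      have e : algebraMap R K j * (y * algebraMap R K i) = t * algebraMap R K i := by
        rw [show (t : K) = y * algebraMap R K j from ht]
        ring
      rw [e]
      exact t.2 _ (algebraMap_mem_toFrac_of_mem hi)
    exact Submodule.mem_one.2 ⟨⟨_, hmem⟩, rfl⟩

/-- Elements of an overring have denominators outside any ideal contracting to a `t`-ideal. -/
theorem IsPVMD.exists_algebraMap_eq_mul (hR : IsPVMD R K) {T : Subalgebra R K} {N : Ideal T}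
    (hN : IsTIdeal K (N.comap (algebraMap R T))) (hN1 : N ≠ ⊤) (t : T) :
    ∃ w : R, algebraMap R T w ∉ N ∧ ∃ r : R, algebraMap R T r = algebraMap R T w * t := by
  have : IsDomain R := (IsFractionRing.injective R K).isDomain (algebraMap R K)
  obtain ⟨a, b, hb, hab⟩ := IsFractionRing.div_surjective (A := R) (t : K)
  have hb0 : algebraMap R K b ≠ 0 := by simpa using nonZeroDivisors.ne_zero hb
  have ha' : a ∈ Ideal.span {a, b} := Ideal.subset_span (by simp)
  have hb' : b ∈ Ideal.span {a, b} := Ideal.subset_span (by simp)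
  obtain ⟨y, hy, j, hj, u, hu, huj⟩ := hR.exists_mul_notMem (J := Ideal.span {a, b})
    (Submodule.fg_span (by simp))
    ((Submodule.ne_bot_iff _).2 ⟨b, hb', nonZeroDivisors.ne_zero hb⟩) hN
    (fun h => hN1 (Ideal.comap_eq_top_iff.1 h))
  obtain ⟨v, hv⟩ := Submodule.mem_one.1 (mem_dual_toFrac_iff.1 hy a ha')
  obtain ⟨w, hw⟩ := Submodule.mem_one.1 (mem_dual_toFrac_iff.1 hy b hb')
  have hvw : algebraMap R T v = algebraMap R T w * t := Subtype.ext (by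
    change algebraMap R K v = algebraMap R K w * t
    rw [hv, hw, ← hab]
    field_simp)
  -- Here `v = y a` and `w = y b`, so `t = v / w`; if `w ∈ N`, then `v = w t` and `u = c v + d w`
  -- would be in `N` too.
  refine ⟨w, fun hwN => hu (Ideal.mem_comap.2 ?_), v, hvw⟩
  obtain ⟨c, d, rfl⟩ := Ideal.mem_span_pair.1 hj
  have huv : u = c * v + d * w := IsFractionRing.injective R K (by
    rw [huj, map_add, map_add, map_mul, map_mul, map_mul, map_mul, hv, hw]; ring)
  rw [huv, map_add, map_mul, map_mul, hvw]
  exact add_mem (N.mul_mem_left _ (N.mul_mem_right _ hwN)) (N.mul_mem_left _ hwN)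

theorem IsPVMD.isTMaximal_of_mem_minimalPrimes (hR : IsPVMD R K)
    (hspec : HasNoetherianTSpectrum R K) {I : Ideal R} (hI : IsTIdeal K I)
    (h : dual (toFrac K I) = Subalgebra.toSubmodule (endRing (toFrac K I)))
    {Q : Ideal (endRing (toFrac K I))}
    (hQ : Q ∈ (I.map (algebraMap R (endRing (toFrac K I)))).minimalPrimes) :
    IsTMaximal K Q := by
  let T := endRing (toFrac K I)
  have hprime := hQ.1.1
  have hQt := (hR.isTIdeal_map_endRing hI).of_mem_minimalPrimes hQ
  refine ⟨⟨hQt, hprime.ne_top⟩, fun N ⟨hN, hN1⟩ hQN t ht => ?_⟩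
  have hNt := hI.comap_endRing hN
  have hNQ : N.comap (algebraMap R T) ≤ Q.comap (algebraMap R T) := by
    intro s hs
    by_contra hsQ
    obtain ⟨J, hJ, hJ0, hJs, hdual⟩ := hR.exists_fg_dual_le_of_notMem hspec
      (hI.comap_endRing hQt) (Ideal.map_le_iff_le_comap.1 hQ.1.2) hsQ
    have hJN : J ≤ N.comap (algebraMap R T) := hJs.trans
      (sup_le ((Ideal.span_singleton_le_iff_mem _).2 hs) (Ideal.comap_mono hQN))
    obtain ⟨y, hy, j, hj, u, hu, huj⟩ := hR.exists_mul_notMem hJ hJ0 hNt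
      (fun h => hN1 (Ideal.comap_eq_top_iff.1 h))
    have hyT : y ∈ T := by
      rw [← Subalgebra.mem_toSubmodule, ← h]
      exact hdual hy
    have e : algebraMap R T u = ⟨y, hyT⟩ * algebraMap R T j := Subtype.ext huj
    exact hu (Ideal.mem_comap.2 (e ▸ N.mul_mem_left _ (hJN hj)))
  obtain ⟨w, hw, r, hr⟩ := hR.exists_algebraMap_eq_mul hNt hN1 t
  have hrQ : algebraMap R T r ∈ Q := hNQ (Ideal.mem_comap.2 (hr ▸ N.mul_mem_left _ ht))
  rw [hr] at hrQ
  exact (hprime.mem_or_mem hrQ).resolve_left fun h => hw (hQN h)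

theorem IsPVMD.radical_le_of_isTMaximal (hR : IsPVMD R K)
    (hspec : HasNoetherianTSpectrum R K) {I : Ideal R} (hI : IsTIdeal K I)
    (hring : IsSubring (dual (toFrac K I)))
    (hmax : ∀ Q ∈ (I.map (algebraMap R (endRing (toFrac K I)))).minimalPrimes, IsTMaximal K Q) :
    I.radical ≤ I := by
  let T := endRing (toFrac K I)
  intro x hx
  by_contra hxI
  have hcolon : ∀ t : T, t ∈ PVMD.colon (I.map (algebraMap R T)) (algebraMap R K x) ↔
      t * algebraMap R T x ∈ I.map (algebraMap R T) := fun t => by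
    rw [mem_colon, ← algebraMap_mem_toFrac (K := K), map_mul]
    rfl
  obtain ⟨N, hle, hN⟩ := IsTIdeal.exists_le_isTMaximal
    ((hR.isTIdeal_map_endRing hI).colon (algebraMap R K x))
    (fun htop => hxI (by
      have h1 := (hcolon 1).1 (htop ▸ Submodule.mem_top)
      rw [one_mul] at h1
      exact algebraMap_mem_toFrac.1 (mem_map_endRing_iff.1 h1)))
  have hNp := hN.isPrime
  have hIN : I.map (algebraMap R T) ≤ N := fun t ht =>
    hle ((hcolon t).2 (Ideal.mul_mem_right _ _ ht))
  obtain ⟨Q, hQ, hQN⟩ := Ideal.exists_minimalPrimes_le hIN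
  obtain rfl : Q = N := (hmax Q hQ).eq_of_le hN.prop hQN
  have hNt := hI.comap_endRing hN.isTIdeal
  obtain ⟨P, hP, hPN⟩ := Ideal.exists_minimalPrimes_le (Ideal.map_le_iff_le_comap.1 hIN)
  have hPp := hP.1.1
  obtain ⟨s, hs, hsx⟩ := hR.exists_mul_mem_of_mem_minimalPrimes hspec hI hring hP
    (hPp.radical_le_iff.2 hP.1.2 hx)
  have hsN : algebraMap R T s ∈ Q := hle ((hcolon _).2 (by
    rw [← map_mul]
    exact Ideal.mem_map_of_mem _ hsx))
  obtain ⟨t, ht, n, htn⟩ := exists_mul_pow_mem_of_mem_minimalPrimes hQ hsN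
  obtain ⟨w, hw, r, hr⟩ := hR.exists_algebraMap_eq_mul hNt hNp.ne_top t
  have hrN : r ∉ P := fun h => (hNp.mem_or_mem (hr ▸ hPN h : _ * t ∈ Q)).elim hw ht
  have hrs : r * s ^ n ∈ I := by
    rw [← algebraMap_mem_toFrac (K := K)]
    refine mem_map_endRing_iff (t := algebraMap R T (r * s ^ n)).1 ?_
    rw [map_mul, hr, map_pow, mul_assoc]
    exact Ideal.mul_mem_left _ _ htn
  exact (hPp.mem_or_mem (hP.1.2 hrs)).elim hrN fun h => hs (hPp.mem_of_pow_mem _ h)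

theorem dual_eq_endRing_of_isRadical {I : Ideal R} (hring : IsSubring (dual (toFrac K I)))
    (hrad : I.IsRadical) :
    dual (toFrac K I) = Subalgebra.toSubmodule (endRing (toFrac K I)) := by
  refine le_antisymm (fun x hx => mem_endRing_toFrac_iff.2 fun i hi => ?_) (endRing_le_dual I)
  obtain ⟨S, hS⟩ := hring
  have hx2 : x * x ∈ dual (toFrac K I) := by
    have hxS : x ∈ S := by
      rw [← SetLike.mem_coe, hS]
      exact hx
    rw [← SetLike.mem_coe, ← hS]
    exact mul_mem hxS hxS
  obtain ⟨r, hr⟩ := Submodule.mem_one.1 (mem_dual_toFrac_iff.1 hx i hi)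
  obtain ⟨q, hq⟩ := Submodule.mem_one.1 (mem_dual_toFrac_iff.1 hx2 i hi)
  have hrq : r ^ 2 = q * i := IsFractionRing.injective R K (by
    rw [map_pow, map_mul, hr, hq]
    ring)
  rw [← hr, algebraMap_mem_toFrac]
  exact hrad ⟨2, hrq ▸ I.mul_mem_left q hi⟩

end EndRing

end PVMD

/-- Conditions equivalent to `I⁻¹ = (I : I)`. In the last one, `I.map _` is `I` itself, seen as an
ideal of the overring `(I : I)`. -/
theorem theorem2p5 {R K : Type*} [CommRing R] [IsDomain R] [Field K] [Algebra R K]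
    [IsFractionRing R K] (hR : PVMD.IsPVMD R K) (hspec : PVMD.HasNoetherianTSpectrum R K)
    (I : Ideal R) (hI : PVMD.IsTIdeal K I)
    (hring : PVMD.IsSubring (PVMD.dual (PVMD.toFrac K I))) :
    List.TFAE [
      PVMD.dual (PVMD.toFrac K I) =
        Subalgebra.toSubmodule (PVMD.endRing (PVMD.toFrac K I)),
      I.radical = I,
      ∀ P ∈ (I.map (algebraMap R (PVMD.endRing (PVMD.toFrac K I)))).minimalPrimes,
        PVMD.IsTMaximal K P] := by
  tfae_have 1 → 3 := fun h _ hP => hR.isTMaximal_of_mem_minimalPrimes hspec hI h hP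
  tfae_have 3 → 2 := fun h =>
    le_antisymm (hR.radical_le_of_isTMaximal hspec hI hring h) Ideal.le_radical
  tfae_have 2 → 1 := fun h => PVMD.dual_eq_endRing_of_isRadical hring h.le
  tfae_finish
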